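/- Let $A$ be a set (of actions). Star expressions over $A$ are given by the grammar $e ::= 0 \mid 1 \mid a \mid e_1+e_2 \mid e_1\cdot e_2 \mid e^*$ with $a\in A$. Immediate termination $e{\downarrow}$ is the least predicate such that $1{\downarrow}$; $(e_1+e_2){\downarrow}$ if $e_1{\downarrow}$ or $e_2{\downarrow}$; $(e_1\cdot e_2){\downarrow}$ if $e_1{\downarrow}$ and $e_2{\downarrow}$; and $(e^*){\downarrow}$. A proof system derives formal equations $e=f$ between star expressions from its axioms by means of its rules; two proof systems are theorem-equivalent, written $\sim$, if they have the same derivable equations (derivable without assumptions). The system $\mathsf{Mil}^-$ has the axioms $(e+f)+g=e+(f+g)$, $e+0=e$, $e+f=f+e$, $e+e=e$, $(e\cdot f)\cdot g=e\cdot(f\cdot g)$, $(e+f)\cdot g=e\cdot g+f\cdot g$, $1\cdot e=e$, $e\cdot 1=e$, $0\cdot e=0$, $e^*=1+e\cdot e^*$, $e^*=(1+e)^*$ for all star expressions $e,f,g$, and the rules of equational logic (reflexivity, symmetry, transitivity, and filling a one-hole context). Milner's system $\mathsf{Mil}$ is $\mathsf{Mil}^-$ plus the rule $\mathsf{RSP}^*$: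 from $e=f\cdot e+g$ infer $e=f^*\cdot g$, provided that not $f{\downarrow}$. For a set $\Gamma$ of equations, $\mathsf{Mil}^-+\Gamma$ is $\mathsf{Mil}^-$ with the equations in $\Gamma$ as additional axioms. A $1$-chart $\mathcal{C}$ consists of a finite set $V$ of vertices, a start vertex $v_s\in V$, a set of transitions $v\xrightarrow{\underline{a}}w$ with $v,w\in V$ and labels $\underline{a}\in A\cup\{1\}$, where $1\notin A$ is the empty-step label, and a set of vertices with immediate termination. It is weakly guarded if it has no cycle of $1$-labeled transitions. It is a loop $1$-chart if (L1) there is an infinite path from $v_s$, (L2) every infinite path from $v_s$ returns to $v_s$ after a positive number of transitions, and (L3) only $v_s$ may have immediate termination; its transitions from $v_s$ are its loop-entry transitions, and its other transitions are its body transitions. A loop sub-$1$-chart of $\mathcal{C}$ at $v\in V$ is a loop $1$-chart with start vertex $v$ that, for a nonempty set $U$ of transitions of $\mathcal{C}$ from $v$, consists of all paths in $\mathcal{C}$ that start with a transition in $U$ and continue onward until $v$ is reached again. Eliminating it means to remove from $\mathcal{C}$ the transitions in $U$, and then all vertices and transitions that become unreachable from $v_s$. $\mathcal{C}$ satisfies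 $\mathrm{LLEE}$ if some finite sequence of successive eliminations of loop sub-$1$-charts leads from $\mathcal{C}$ to a $1$-chart without an infinite path, and in this sequence no loop-entry transition is ever removed that is a body transition of a previously eliminated loop sub-$1$-chart. Let $S$ be a proof system that extends $\mathsf{Mil}^-$. A function $s$ from the vertices of $\mathcal{C}$ to star expressions is an $S$-provable solution of $\mathcal{C}$ if for every vertex $v$, with $v\xrightarrow{\underline{a}_i}v_i$ ($1\le i\le n$) a finite list of all transitions from $v$, the equation $s(v)=\tau(v)+\sum_{i=1}^n \underline{a}_i\cdot s(v_i)$ is derivable in $S$, where $\tau(v)=1$ if $v$ has immediate termination and $\tau(v)=0$ otherwise. A coinductive proof over $S$ of an equation $e=f$ is a weakly guarded $1$-chart $\mathcal{C}$ together with a labeling of its vertices by equations such that the left-hand sides, and the right-hand sides, of these equations each form an $S$-provable solution of $\mathcal{C}$, and such that the label of the start vertex is $e=f$. It is $\mathrm{LLEE}$-witnessed if $\mathcal{C}$ satisfies $\mathrm{LLEE}$. For $n\in\mathbb{N}$, the rule $\mathsf{LCoindProof}_n$ permits to infer $e=f$ from $n$ equation premises $g_1=h_1,\dots,g_n=h_n$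 together with, as an $(n+1)$-th premise, an $\mathrm{LLEE}$-witnessed coinductive proof of $e=f$ over $\mathsf{Mil}^-+\{g_1=h_1,\dots,g_n=h_n\}$. The system $\mathsf{cMil}$ is $\mathsf{Mil}^-$ plus the rules $\mathsf{LCoindProof}_n$ for all $n\in\mathbb{N}$; $\mathsf{cMil}_1$ is $\mathsf{Mil}^-$ plus only the rule $\mathsf{LCoindProof}_1$; and $\mathsf{CLC}$ has no axioms, and only the rules $\mathsf{LCoindProof}_n$ for all $n\in\mathbb{N}$. Theorem. $\mathsf{Mil}\sim\mathsf{cMil}_1\sim\mathsf{cMil}\sim\mathsf{CLC}$, that is, these four proof systems have the same derivable equations. -/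

import Mathlib

universe u

namespace StarProof

/-! ### Star expressions, formal equations, immediate termination -/

/-- Star expressions over a set `A` of actions. -/
inductive StExp (A : Type u) : Type u
  | zero : StExp A
  | one : StExp A
  | act : A → StExp A
  | sum : StExp A → StExp A → StExp A
  | prod : StExp A → StExp A → StExp A
  | star : StExp A → StExp A

/-- Formal equations between star expressions. -/
@[ext]
structure StExpEq (A : Type u) : Type u where
  lhs : StExp A
  rhs : StExp A

/-- Immediate termination of star expressions. -/
inductive StExp.Terminates {A : Type u} : StExp A → Prop
  | one : Terminates StExp.one
  | sumL {e f : StExp A} : Terminates e → Terminates (StExp.sum e f)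
  | sumR {e f : StExp A} : Terminates f → Terminates (StExp.sum e f)
  | prod {e f : StExp A} : Terminates e → Terminates f → Terminates (StExp.prod e f)
  | star (e : StExp A) : Terminates (StExp.star e)

/-- Finite sums, associated to the left: the empty sum is `0`, a one-element sum is its summand,
and `e₁ + … + eₙ` is `(e₁ + … + eₙ₋₁) + eₙ`. -/
def StExp.sumList {A : Type u} : List (StExp A) → StExp A
  | [] => StExp.zero
  | e :: es => es.foldl StExp.sum e

/-- Star expression contexts with precisely one hole. -/
inductive Cxt (A : Type u) : Type u
  | hole : Cxt A
  | sumL : Cxt A → StExp A → Cxt A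
  | sumR : StExp A → Cxt A → Cxt A
  | prodL : Cxt A → StExp A → Cxt A
  | prodR : StExp A → Cxt A → Cxt A
  | star : Cxt A → Cxt A

/-- Filling the hole of a context. -/
def Cxt.fill {A : Type u} : Cxt A → StExp A → StExp A
  | .hole, e => e
  | .sumL C f, e => .sum (C.fill e) f
  | .sumR f C, e => .sum f (C.fill e)
  | .prodL C f, e => .prod (C.fill e) f
  | .prodR f C, e => .prod f (C.fill e)
  | .star C, e => .star (C.fill e)

/-! ### Proof systems -/

/-- A proof system for equations between star expressions: a set of axioms, and a set of rule
instances, each with a finite list of premises and a conclusion. -/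
structure ProofSystem (A : Type u) : Type u where
  axioms : Set (StExpEq A)
  rule : List (StExpEq A) → StExpEq A → Prop

/-- Derivability (without assumptions) in a proof system. -/
inductive ProofSystem.Derivable {A : Type u} (S : ProofSystem A) : StExpEq A → Prop
  | ax {q : StExpEq A} : q ∈ S.axioms → Derivable S q
  | rule {ps : List (StExpEq A)} {q : StExpEq A} :
      S.rule ps q → (∀ p ∈ ps, Derivable S p) → Derivable S q

/-- Theorem equivalence: the two systems have the same derivable equations. -/
def ThmEquiv {A : Type u} (S₁ S₂ : ProofSystem A) : Prop :=
  ∀ q : StExpEq A, S₁.Derivable q ↔ S₂.Derivable q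

/-- `S + Γ`: the system `S` with the equations in `Γ` as additional axioms. -/
def ProofSystem.addAxioms {A : Type u} (S : ProofSystem A) (Γ : Set (StExpEq A)) :
    ProofSystem A where
  axioms := S.axioms ∪ Γ
  rule := S.rule

/-- The system `S` with additional rule instances. -/
def ProofSystem.addRules {A : Type u} (S : ProofSystem A)
    (R : List (StExpEq A) → StExpEq A → Prop) : ProofSystem A where
  axioms := S.axioms
  rule := fun ps q => S.rule ps q ∨ R ps q

/-- The rules of equational logic: reflexivity, symmetry, transitivity, filling a context. -/
inductive ELRule {A : Type u} : List (StExpEq A) → StExpEq A → Prop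
  | refl (e : StExp A) : ELRule [] ⟨e, e⟩
  | symm (e f : StExp A) : ELRule [⟨e, f⟩] ⟨f, e⟩
  | trans (e f g : StExp A) : ELRule [⟨e, f⟩, ⟨f, g⟩] ⟨e, g⟩
  | cxt (C : Cxt A) (e f : StExp A) : ELRule [⟨e, f⟩] ⟨C.fill e, C.fill f⟩

/-- The axioms of `Mil⁻`. -/
inductive MilAxiom {A : Type u} : StExpEq A → Prop
  | assocSum (e f g : StExp A) : MilAxiom ⟨.sum (.sum e f) g, .sum e (.sum f g)⟩
  | neutralSum (e : StExp A) : MilAxiom ⟨.sum e .zero, e⟩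
  | commSum (e f : StExp A) : MilAxiom ⟨.sum e f, .sum f e⟩
  | idempotSum (e : StExp A) : MilAxiom ⟨.sum e e, e⟩
  | assocProd (e f g : StExp A) : MilAxiom ⟨.prod (.prod e f) g, .prod e (.prod f g)⟩
  | rDistr (e f g : StExp A) : MilAxiom ⟨.prod (.sum e f) g, .sum (.prod e g) (.prod f g)⟩
  | idL (e : StExp A) : MilAxiom ⟨.prod .one e, e⟩
  | idR (e : StExp A) : MilAxiom ⟨.prod e .one, e⟩
  | deadlock (e : StExp A) : MilAxiom ⟨.prod .zero e, .zero⟩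
  | recStar (e : StExp A) : MilAxiom ⟨.star e, .sum .one (.prod e (.star e))⟩
  | trmBody (e : StExp A) : MilAxiom ⟨.star e, .star (.sum .one e)⟩

/-- The rule `RSP*`: from `e = f · e + g` infer `e = f* · g`, provided that `f` does not
terminate immediately. -/
inductive RSPStar {A : Type u} : List (StExpEq A) → StExpEq A → Prop
  | mk (e f g : StExp A) (hf : ¬ f.Terminates) :
      RSPStar [⟨e, .sum (.prod f e) g⟩] ⟨e, .prod (.star f) g⟩

/-- The system `Mil⁻`. -/
def MilMinus (A : Type u) : ProofSystem A where
  axioms := {q | MilAxiom q}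
  rule := ELRule

/-- Milner's system `Mil`. -/
def Mil (A : Type u) : ProofSystem A :=
  (MilMinus A).addRules RSPStar

/-! ### 1-charts -/

/-- Labeled transitions `⟨source, label, target⟩`. The label `none` is the empty-step label `1`,
the label `some a` is the proper action `a`. -/
abbrev Trans (A : Type u) (V : Type u) : Type u := V × Option A × V

/-- 1-charts with actions in `A`. -/
structure OneChart (A : Type u) : Type (u + 1) where
  V : Type u
  finite : Finite V
  start : V
  trans : Set (Trans A V)
  term : Set V

/-- A 1-chart is weakly guarded if it has no cycle of 1-transitions. -/
def OneChart.WeaklyGuarded {A : Type u} (C : OneChart A) : Prop :=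
  ∀ v : C.V, ¬ Relation.TransGen (fun x y => (x, none, y) ∈ C.trans) v v

section Loops

variable {A V : Type u}

/-- `p` is an infinite path (given by its transitions) from `v` in the transition set `T`. -/
def IsInfPath (T : Set (Trans A V)) (v : V) (p : ℕ → Trans A V) : Prop :=
  (p 0).1 = v ∧ ∀ i, p i ∈ T ∧ (p i).2.2 = (p (i + 1)).1

/-- The conditions (L1), (L2), (L3) on a loop 1-chart with start vertex `s`, transition set `T`,
and set `F` of vertices with immediate termination. -/
structure IsLoopChart (s : V) (T : Set (Trans A V)) (F : Set V) : Prop where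
  exists_infPath : ∃ p, IsInfPath T s p
  returns : ∀ p, IsInfPath T s p → ∃ n, 0 < n ∧ (p n).1 = s
  term_subset : F ⊆ {s}

/-- The transitions of the sub-1-chart that consists of all paths in `T` that start with a
transition in `U` and continue onward until `v` is reached again. -/
inductive SubTrans (T : Set (Trans A V)) (v : V) (U : Set (Trans A V)) : Trans A V → Prop
  | entry {t : Trans A V} : t ∈ U → SubTrans T v U t
  | step {t t' : Trans A V} : SubTrans T v U t → t.2.2 ≠ v → t' ∈ T → t'.1 = t.2.2 →
      SubTrans T v U t'

/-- The vertices of that sub-1-chart. -/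
def subVerts (T : Set (Trans A V)) (v : V) (U : Set (Trans A V)) : Set V :=
  {w | w = v ∨ ∃ t, SubTrans T v U t ∧ t.2.2 = w}

/-- The body transitions of that sub-1-chart: those that do not depart from `v`. -/
def bodyTrans (T : Set (Trans A V)) (v : V) (U : Set (Trans A V)) : Set (Trans A V) :=
  {t | SubTrans T v U t ∧ t.1 ≠ v}

/-- The nonempty set `U` of transitions from `v` induces a loop sub-1-chart, with start vertex `v`,
of the 1-chart with transition set `T` and set `F` of vertices with immediate termination. -/
structure IsLoopSubChart (T : Set (Trans A V)) (F : Set V) (v : V) (U : Set (Trans A V)) :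
    Prop where
  nonempty : U.Nonempty
  subset : U ⊆ T
  source : ∀ t ∈ U, t.1 = v
  isLoop : IsLoopChart v {t | SubTrans T v U t} (F ∩ subVerts T v U)

/-- `w` is reachable from `s` via transitions in `T`. -/
def Reachable (T : Set (Trans A V)) (s w : V) : Prop :=
  Relation.ReflTransGen (fun x y => ∃ l, (x, l, y) ∈ T) s w

/-- The result of removing the transitions in `U` from `T`, and also all transitions
from vertices that thereby become unreachable from `s`. -/
def eliminate (s : V) (T U : Set (Trans A V)) : Set (Trans A V) :=
  {t | t ∈ T \ U ∧ (Reachable T s t.1 → Reachable (T \ U) s t.1)}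

end Loops

/-- Runs of the layered loop elimination procedure on `C`: `C.LayeredRun T B` means that there is a
sequence of loop eliminations from `C` that leads to the transition set `T`, in which `B` is the
set of all body transitions of the eliminated loop sub-1-charts, and in which never a loop-entry
transition is removed from the body of a previously eliminated loop sub-1-chart. -/
inductive OneChart.LayeredRun {A : Type u} (C : OneChart A) :
    Set (Trans A C.V) → Set (Trans A C.V) → Prop
  | init : LayeredRun C C.trans ∅
  | step {T B U : Set (Trans A C.V)} {v : C.V} :
      LayeredRun C T B → IsLoopSubChart T C.term v U → Disjoint U B →
      LayeredRun C (eliminate C.start T U) (B ∪ bodyTrans T v U)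

/-- `LLEE`, layered loop existence and elimination: some layered run of the loop elimination
procedure leads to a 1-chart without an infinite path. -/
def OneChart.LLEE {A : Type u} (C : OneChart A) : Prop :=
  ∃ T B, C.LayeredRun T B ∧ ¬ ∃ v p, IsInfPath T v p

/-! ### Provable solutions and coinductive proofs -/

/-- The star expression for a transition label: the empty-step label stands for `1`. -/
def labelExp {A : Type u} : Option A → StExp A
  | none => .one
  | some a => .act a

open Classical in
/-- The termination constant of `C` at `v`. -/
noncomputable def OneChart.termConst {A : Type u} (C : OneChart A) (v : C.V) : StExp A :=
  if v ∈ C.term then .one else .zero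

/-- `s` is an `S`-provable solution of `C`: at every vertex `v`, for a (possibly redundant) list
representation `l` of the labels and targets of the transitions from `v`, the equation between
`s v` and the termination constant plus the sum over `l` is derivable in `S`.
(For systems that contain the axioms of `Mil⁻` and the rules of equational logic
the choice of `l` does not matter.) -/
def OneChart.IsSolution {A : Type u} (C : OneChart A) (S : ProofSystem A)
    (s : C.V → StExp A) : Prop :=
  ∀ v : C.V, ∃ l : List (Option A × C.V),
    (∀ x : Option A × C.V, x ∈ l ↔ (v, x.1, x.2) ∈ C.trans) ∧
    S.Derivable ⟨s v, .sum (C.termConst v)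
      (StExp.sumList (l.map fun x => .prod (labelExp x.1) (s x.2)))⟩

/-- Coinductive proofs of the equation `q` over `S`. -/
structure CoindProof {A : Type u} (S : ProofSystem A) (q : StExpEq A) : Type (u + 1) where
  chart : OneChart A
  weaklyGuarded : chart.WeaklyGuarded
  label : chart.V → StExpEq A
  solution_lhs : chart.IsSolution S fun v => (label v).lhs
  solution_rhs : chart.IsSolution S fun v => (label v).rhs
  label_start : label chart.start = q

/-- A coinductive proof is `LLEE`-witnessed if its underlying 1-chart satisfies `LLEE`. -/
def CoindProof.LLEEWitnessed {A : Type u} {S : ProofSystem A} {q : StExpEq A}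
    (P : CoindProof S q) : Prop :=
  P.chart.LLEE

/-! ### The coinductive proof systems -/

/-- The instances of the rule `LCoindProofₙ`. They have `n` equation premises `ps`, and as their
`(n+1)`-th premise an `LLEE`-witnessed coinductive proof of the conclusion over `Mil⁻` plus the
equations in `ps`. The latter is an object that is checked and not derived, and therefore it
appears here as a condition on the instance. -/
def LCoindProof {A : Type u} (n : ℕ) (ps : List (StExpEq A)) (q : StExpEq A) : Prop :=
  ps.length = n ∧ ∃ P : CoindProof ((MilMinus A).addAxioms {p | p ∈ ps}) q, P.LLEEWitnessed

/-- The system `CLC` for combining `LLEE`-witnessed coinductive proofs: it has no axioms, and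
the rules `LCoindProofₙ` for all `n`. -/
def CLC (A : Type u) : ProofSystem A where
  axioms := ∅
  rule := fun ps q => ∃ n, LCoindProof n ps q

/-- The coinductive variant `cMil` of Milner's system. -/
def CMil (A : Type u) : ProofSystem A :=
  (MilMinus A).addRules fun ps q => ∃ n, LCoindProof n ps q

/-- The simple coinductive variant `cMil₁` of Milner's system. -/
def CMil1 (A : Type u) : ProofSystem A :=
  (MilMinus A).addRules (LCoindProof 1)

end StarProof

/-!
The systems are compared along `Mil ⊆ cMil₁ ⊆ cMil ⊆ Mil` and `cMil ⊆ CLC ⊆ cMil`. Two facts about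
1-charts carry the proof; the remaining inclusions are immediate.

*Existence.* Every star expression `e` occurs at the start of a `Mil⁻`-provable solution of a
weakly guarded `LLEE`-1-chart (`Frag.exists_sol`). The 1-chart is built by recursion on `e`, in the
manner of a position automaton. In an iteration `e*`, however, the terminating positions of `e`
lose their termination and get a 1-transition back to one new vertex that represents `e*`. Hence
the positions of `e` form the body of loops at that vertex, and eliminating inner iterations before
outer ones is a layered elimination (`LoopWitness.llee`). The start vertex has no incoming
transitions, so its value may be replaced by any provably equal expression. This makes each theorem
of `Mil⁻ + Γ` the conclusion of an `LLEE`-witnessed coinductive proof over `Mil⁻ + Γ`, and gives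
`cMil ⊆ CLC` (`exists_coindProof_of_derivable`). For an instance of `RSP*` with premise
`e = f · e + g`, the 1-chart of `f* · g` has a second solution over `Mil⁻` plus the premise, in
which `f* · g` is replaced by `e` (`Frag.Sol.star_prod`). This gives `Mil ⊆ cMil₁`.

*Uniqueness.* Any two solutions of a weakly guarded `LLEE`-1-chart are provably equal in `Mil`
(`solution_unique`), which gives `cMil ⊆ Mil`. Solutions are followed through the loop
eliminations. When the loop at `v` with entries `U` is eliminated, every solution `s` satisfies
`s w = e_w · s v` at the vertices `w` of the body, with `e_w` independent of `s`, because every path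
in the body leads to `v` or ends. The summands of the equation at `v` that stem from `U` thus
combine to `(Σ a · e_w) · s v`. The expression `Σ a · e_w` does not terminate immediately, since
otherwise there would be a cycle of 1-transitions, and therefore `RSP*` can solve such equations.
When no infinite path is left, the equations determine `s` by well-founded recursion.

All calculations take place in the quotient of the star expressions by provable equality
(`ProvQuot`), where sums are sums in a commutative idempotent monoid.
-/

namespace StarProof

/-! ### Star expressions modulo provable equality -/

/-- `S` derives the axioms of `Mil⁻`, and its theorems are closed under equational logic. -/
structure ExtendsMilMinus {A : Type u} (S : ProofSystem A) : Prop where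
  ax : ∀ {q}, MilAxiom q → S.Derivable q
  el : ∀ {ps q}, ELRule ps q → (∀ p ∈ ps, S.Derivable p) → S.Derivable q

section Quotient

variable {A : Type u} {S : ProofSystem A}

namespace ExtendsMilMinus

theorem refl (h : ExtendsMilMinus S) (e : StExp A) : S.Derivable ⟨e, e⟩ :=
  h.el (.refl e) (by simp)

theorem symm (h : ExtendsMilMinus S) {e f : StExp A} (p : S.Derivable ⟨e, f⟩) :
    S.Derivable ⟨f, e⟩ :=
  h.el (.symm e f) (by simpa using p)

theorem trans (h : ExtendsMilMinus S) {e f g : StExp A} (p : S.Derivable ⟨e, f⟩)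
    (q : S.Derivable ⟨f, g⟩) : S.Derivable ⟨e, g⟩ :=
  h.el (.trans e f g) (by simp [p, q])

theorem cxt (h : ExtendsMilMinus S) (C : Cxt A) {e f : StExp A} (p : S.Derivable ⟨e, f⟩) :
    S.Derivable ⟨C.fill e, C.fill f⟩ :=
  h.el (.cxt C e f) (by simpa using p)

theorem sum_congr (h : ExtendsMilMinus S) {e e' f f' : StExp A} (p : S.Derivable ⟨e, e'⟩)
    (q : S.Derivable ⟨f, f'⟩) : S.Derivable ⟨.sum e f, .sum e' f'⟩ :=
  h.trans (h.cxt (.sumL .hole f) p) (h.cxt (.sumR e' .hole) q)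

theorem prod_congr (h : ExtendsMilMinus S) {e e' f f' : StExp A} (p : S.Derivable ⟨e, e'⟩)
    (q : S.Derivable ⟨f, f'⟩) : S.Derivable ⟨.prod e f, .prod e' f'⟩ :=
  h.trans (h.cxt (.prodL .hole f) p) (h.cxt (.prodR e' .hole) q)

/-- Provable equality of star expressions. -/
def setoid (h : ExtendsMilMinus S) : Setoid (StExp A) where
  r e f := S.Derivable ⟨e, f⟩
  iseqv := ⟨h.refl, h.symm, h.trans⟩

end ExtendsMilMinus

/-- Star expressions modulo provable equality in an extension of `Mil⁻`. This is a commutative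
idempotent monoid under `+` and a monoid under `*`. Multiplication distributes over sums from the
right only, and `x * 0 = 0` need not hold. -/
def ProvQuot (h : ExtendsMilMinus S) : Type u := Quotient h.setoid

variable {h : ExtendsMilMinus S}

/-- The class of a star expression modulo provable equality. -/
def cls (h : ExtendsMilMinus S) (e : StExp A) : ProvQuot h := Quotient.mk h.setoid e

theorem cls_eq_iff {e f : StExp A} : cls h e = cls h f ↔ S.Derivable ⟨e, f⟩ :=
  Quotient.eq (r := h.setoid)

theorem cls_eq_of_axiom {e f : StExp A} (p : MilAxiom ⟨e, f⟩) : cls h e = cls h f :=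
  cls_eq_iff.2 (h.ax p)

theorem ProvQuot.ind {P : ProvQuot h → Prop} (H : ∀ e, P (cls h e)) (x : ProvQuot h) : P x :=
  Quotient.ind H x

instance : Add (ProvQuot h) :=
  ⟨Quotient.map₂ StExp.sum fun _ _ p _ _ q => h.sum_congr p q⟩

instance : Mul (ProvQuot h) :=
  ⟨Quotient.map₂ StExp.prod fun _ _ p _ _ q => h.prod_congr p q⟩

instance : Zero (ProvQuot h) := ⟨cls h .zero⟩

instance : One (ProvQuot h) := ⟨cls h .one⟩

theorem cls_zero : cls h .zero = 0 := rfl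
theorem cls_one : cls h .one = 1 := rfl
theorem cls_sum (e f : StExp A) : cls h (.sum e f) = cls h e + cls h f := rfl
theorem cls_prod (e f : StExp A) : cls h (.prod e f) = cls h e * cls h f := rfl

theorem cls_star_congr {e f : StExp A} (p : cls h e = cls h f) :
    cls h (.star e) = cls h (.star f) :=
  cls_eq_iff.2 (h.cxt (.star .hole) (cls_eq_iff.1 p))

instance : AddCommMonoid (ProvQuot h) where
  add_assoc x y z := by
    induction x using ProvQuot.ind; induction y using ProvQuot.ind
    induction z using ProvQuot.ind
    exact cls_eq_of_axiom (.assocSum _ _ _)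
  add_comm x y := by
    induction x using ProvQuot.ind; induction y using ProvQuot.ind
    exact cls_eq_of_axiom (.commSum _ _)
  add_zero x := by
    induction x using ProvQuot.ind
    exact cls_eq_of_axiom (.neutralSum _)
  zero_add x := by
    induction x using ProvQuot.ind
    exact (cls_eq_of_axiom (.commSum _ _)).trans (cls_eq_of_axiom (.neutralSum _))
  nsmul := nsmulRec

instance : Monoid (ProvQuot h) where
  mul_assoc x y z := by
    induction x using ProvQuot.ind; induction y using ProvQuot.ind
    induction z using ProvQuot.ind
    exact cls_eq_of_axiom (.assocProd _ _ _)
  mul_one x := by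
    induction x using ProvQuot.ind
    exact cls_eq_of_axiom (.idR _)
  one_mul x := by
    induction x using ProvQuot.ind
    exact cls_eq_of_axiom (.idL _)

instance : RightDistribClass (ProvQuot h) where
  right_distrib x y z := by
    induction x using ProvQuot.ind; induction y using ProvQuot.ind
    induction z using ProvQuot.ind
    exact cls_eq_of_axiom (.rDistr _ _ _)

namespace ProvQuot

theorem zero_mul (x : ProvQuot h) : 0 * x = 0 := by
  induction x using ProvQuot.ind
  exact cls_eq_of_axiom (.deadlock _)

theorem add_self (x : ProvQuot h) : x + x = x := by
  induction x using ProvQuot.ind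
  exact cls_eq_of_axiom (.idempotSum _)

theorem list_sum_mul {ι : Type*} (l : List ι) (f : ι → ProvQuot h) (c : ProvQuot h) :
    (l.map f).sum * c = (l.map fun i => f i * c).sum := by
  induction l with
  | nil => simp [zero_mul]
  | cons i l ih => simp [add_mul, ih]

theorem add_list_sum_of_mem {ι : Type*} {l : List ι} {i : ι} (hi : i ∈ l)
    (f : ι → ProvQuot h) : f i + (l.map f).sum = (l.map f).sum := by
  induction l with
  | nil => simp at hi
  | cons j l ih =>
    rw [List.map_cons, List.sum_cons]
    rcases List.mem_cons.1 hi with rfl | hi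
    · rw [← add_assoc, add_self]
    · rw [add_left_comm, ih hi]

theorem list_sum_add_of_subset {ι : Type*} {l l' : List ι} (hl : l ⊆ l')
    (f : ι → ProvQuot h) : (l.map f).sum + (l'.map f).sum = (l'.map f).sum := by
  induction l with
  | nil => simp
  | cons i l ih =>
    rw [List.cons_subset] at hl
    rw [List.map_cons, List.sum_cons, add_assoc, ih hl.2, add_list_sum_of_mem hl.1]

/-- Sums over lists depend only on the set of list members, since addition is idempotent. -/
theorem list_sum_congr {ι : Type*} {l l' : List ι} (hl : ∀ i, i ∈ l ↔ i ∈ l')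
    (f : ι → ProvQuot h) : (l.map f).sum = (l'.map f).sum := by
  rw [← list_sum_add_of_subset (fun i hi => (hl i).1 hi) f, add_comm,
    list_sum_add_of_subset (fun i hi => (hl i).2 hi) f]

end ProvQuot

theorem cls_sumList (l : List (StExp A)) : cls h (StExp.sumList l) = (l.map (cls h)).sum := by
  have key : ∀ (l : List (StExp A)) (e : StExp A),
      cls h (l.foldl StExp.sum e) = cls h e + (l.map (cls h)).sum := by
    intro l
    induction l with
    | nil => simp
    | cons f l ih => intro e; simp [ih, cls_sum, add_assoc]
  cases l with
  | nil => rfl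
  | cons e l => simp [StExp.sumList, key]

theorem cls_star (e : StExp A) : cls h (.star e) = 1 + cls h e * cls h (.star e) :=
  cls_eq_of_axiom (.recStar e)

/-- The unfolding of an iteration whose body is split into an optional summand `1` and a rest. -/
theorem cls_star_eq_of_body {e g : StExp A} {b : Bool}
    (he : cls h e = (if b then 1 else 0) + cls h g) :
    cls h (.star e) = 1 + cls h g * cls h (.star e) := by
  have : cls h (.star e) = cls h (.star g) := by
    cases b
    · exact cls_star_congr (by simpa using he)
    · rw [cls_eq_of_axiom (h := h) (.trmBody g)]
      exact cls_star_congr (by simpa [cls_sum, cls_one] using he)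
  rw [this, ← cls_star]

/-- The contribution of a list of transitions, given by labels and targets, to the right-hand side
of the equation for a vertex. -/
def lin {V : Type*} (s : V → ProvQuot h) (l : List (Option A × V)) : ProvQuot h :=
  (l.map fun x => cls h (labelExp x.1) * s x.2).sum

theorem cls_sumList_label {ι : Type*} (l : List ι) (a : ι → Option A) (s : ι → StExp A) :
    cls h (StExp.sumList (l.map fun x => .prod (labelExp (a x)) (s x))) =
      (l.map fun x => cls h (labelExp (a x)) * cls h (s x)).sum := by
  rw [cls_sumList, List.map_map]
  rfl

theorem cls_sumList_lin {V : Type*} (l : List (Option A × V)) (s : V → StExp A) :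
    cls h (StExp.sumList (l.map fun x => .prod (labelExp x.1) (s x.2))) =
      lin (fun v => cls h (s v)) l :=
  cls_sumList_label l _ _

theorem lin_append {V : Type*} (s : V → ProvQuot h) (l l' : List (Option A × V)) :
    lin s (l ++ l') = lin s l + lin s l' := by
  simp [lin]

theorem lin_nil {V : Type*} (s : V → ProvQuot h) : lin s [] = 0 := rfl

theorem lin_map {V W : Type*} (s : W → ProvQuot h) (g : V → W) (l : List (Option A × V)) :
    lin s (l.map (Prod.map id g)) = lin (fun v => s (g v)) l := by
  simp [lin, Function.comp_def]

theorem lin_mul {V : Type*} (s : V → ProvQuot h) (c : ProvQuot h) (l : List (Option A × V)) :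
    lin s l * c = lin (fun v => s v * c) l := by
  simp [lin, ProvQuot.list_sum_mul, mul_assoc]

theorem lin_congr {V : Type*} (s : V → ProvQuot h) {l l' : List (Option A × V)}
    (hl : ∀ x, x ∈ l ↔ x ∈ l') : lin s l = lin s l' :=
  ProvQuot.list_sum_congr hl _

open Classical in
/-- The defining equations of a solution, read modulo provable equality. -/
theorem isSolution_iff (h : ExtendsMilMinus S) {C : OneChart A} {s : C.V → StExp A} :
    C.IsSolution S s ↔ ∀ v, ∃ l : List (Option A × C.V),
      (∀ x : Option A × C.V, x ∈ l ↔ (v, x.1, x.2) ∈ C.trans) ∧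
      cls h (s v) = (if v ∈ C.term then 1 else 0) + lin (fun w => cls h (s w)) l := by
  refine forall_congr' fun v => exists_congr fun l => and_congr_right fun _ => ?_
  rw [← cls_eq_iff (h := h), cls_sum, cls_sumList_lin]
  have : cls h (C.termConst v) = if v ∈ C.term then 1 else 0 := by
    unfold OneChart.termConst
    split_ifs <;> rfl
  rw [this]

end Quotient

/-! ### A criterion for `LLEE` -/

section Criterion

variable {A V : Type u}

/-- A certificate for `LLEE` and weak guardedness of the 1-chart with transition lists `out` and
termination predicate `term`. Each vertex `v` has a `region`, the body of the loops at `v`, which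
is empty if `v` is not in the list `heads` of loop vertices, and the loop-entry transitions at `v`
are those into its region. Regions cannot be left except to their head, do not contain
terminating vertices, and inner heads precede outer ones in `heads`. All transitions that are not
loop-entry transitions decrease `rank`. -/
structure LoopWitness (out : V → List (Option A × V)) (term : V → Bool) where
  region : V → Set V
  heads : List V
  rank : V → ℕ
  bound : ℕ
  mem_heads : ∀ {v w}, w ∈ region v → v ∈ heads
  entry_proper : ∀ {v l w}, (l, w) ∈ out v → w ∈ region v → l ≠ none
  region_closed : ∀ {v w l y}, w ∈ region v → (l, y) ∈ out w → y ∈ region v ∨ y = v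
  region_term : ∀ {v w}, w ∈ region v → term w = false
  notMem_region : ∀ v, v ∉ region v
  order : heads.Pairwise fun x y => y ∉ region x
  rank_lt : ∀ v, rank v < bound
  rank_dec : ∀ {v l w}, (l, w) ∈ out v → w ∉ region v → rank w < rank v

/-- The 1-chart given by lists of outgoing transitions and a termination predicate. -/
def chartOf (V : Type u) [Finite V] (start : V) (out : V → List (Option A × V))
    (term : V → Bool) : OneChart A where
  V := V
  finite := inferInstance
  start := start
  trans := {t | (t.2.1, t.2.2) ∈ out t.1}
  term := {v | term v = true}

theorem IsInfPath.add {T : Set (Trans A V)} {v : V} {p : ℕ → Trans A V} (hp : IsInfPath T v p)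
    (n : ℕ) : IsInfPath T (p n).1 fun i => p (n + i) :=
  ⟨rfl, fun i => hp.2 (n + i)⟩

theorem SubTrans.exists_mem {T : Set (Trans A V)} {v : V} {U : Set (Trans A V)} {t : Trans A V}
    (ht : SubTrans T v U t) : U.Nonempty := by
  induction ht with
  | entry h => exact ⟨_, h⟩
  | step _ _ _ _ ih => exact ih

variable {out : V → List (Option A × V)} {term : V → Bool}

namespace LoopWitness

/-- The transitions from `x` in `T` into the region of `x`. -/
def entries (W : LoopWitness out term) (T : Set (Trans A V)) (x : V) : Set (Trans A V) :=
  {t | t ∈ T ∧ t.1 = x ∧ t.2.2 ∈ W.region x}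

theorem subTrans_entries (W : LoopWitness out term) {T : Set (Trans A V)}
    (hT : ∀ t ∈ T, (t.2.1, t.2.2) ∈ out t.1) {x : V} {t : Trans A V}
    (ht : SubTrans T x (W.entries T x) t) :
    t ∈ T ∧ (t.1 = x ∨ t.1 ∈ W.region x) ∧ (t.2.2 ∈ W.region x ∨ t.2.2 = x) := by
  induction ht with
  | entry h => exact ⟨h.1, .inl h.2.1, .inl h.2.2⟩
  | @step t t' _ hne ht' heq ih =>
    have hr : t'.1 ∈ W.region x := heq ▸ ih.2.2.resolve_right hne
    exact ⟨ht', .inr hr, W.region_closed hr (hT _ ht')⟩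

/-- A path of `T` that starts in a loop-entry transition at `x` and later visits `x` again gives
rise to an infinite path from `x` inside the induced sub-1-chart: repeat its first cycle. -/
theorem exists_infPath_of_return (W : LoopWitness out term) {T : Set (Trans A V)} {x : V}
    {p : ℕ → Trans A V} (hp : IsInfPath T x p) (h0 : p 0 ∈ W.entries T x)
    (hret : ∃ n, 0 < n ∧ (p n).1 = x) :
    ∃ q, IsInfPath {t | SubTrans T x (W.entries T x) t} x q := by
  classical
  obtain ⟨hm0, hmx⟩ := Nat.find_spec hret
  have hmin : ∀ i, 0 < i → i < Nat.find hret → (p i).1 ≠ x := fun i hi hlt hx =>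
    Nat.find_min hret hlt ⟨hi, hx⟩
  generalize Nat.find hret = m at *
  have hsub : ∀ i, i < m → SubTrans T x (W.entries T x) (p i) := by
    intro i
    induction i with
    | zero => intro _; exact .entry h0
    | succ i ih =>
      intro hi
      refine .step (ih (by omega)) ?_ (hp.2 _).1 (hp.2 i).2.symm
      rw [(hp.2 i).2]
      exact hmin _ (by omega) hi
  refine ⟨fun i => p (i % m), by simpa using hp.1, fun i => ⟨hsub _ (Nat.mod_lt _ hm0), ?_⟩⟩
  have hlt := Nat.mod_lt i hm0
  change (p (i % m)).2.2 = (p ((i + 1) % m)).1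
  rw [(hp.2 _).2, Nat.add_mod_eq_ite]
  by_cases h1 : i % m + 1 = m
  · by_cases hm1 : m = 1
    · subst hm1
      simp [Nat.mod_one, hmx, hp.1]
    · rw [Nat.mod_eq_of_lt (show 1 < m by omega), if_pos h1.ge, h1, Nat.sub_self, hmx, hp.1]
  · rw [Nat.mod_eq_of_lt (show 1 < m by omega), if_neg (by omega)]

theorem isLoopSubChart (W : LoopWitness out term) {T : Set (Trans A V)}
    (hT : ∀ t ∈ T, (t.2.1, t.2.2) ∈ out t.1) {x : V} {L : List V}
    (hL : ∀ y ∈ x :: L, y ∉ W.region x)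
    (hinf : ¬ ∃ v p, IsInfPath {t | t ∈ T ∧ (t.2.2 ∈ W.region t.1 → t.1 ∉ x :: L)} v p)
    (hx : ∃ p, IsInfPath {t | SubTrans T x (W.entries T x) t} x p) :
    IsLoopSubChart T {v | term v = true} x (W.entries T x) where
  nonempty := by
    obtain ⟨p, hp⟩ := hx
    exact SubTrans.exists_mem (hp.2 0).1
  subset t ht := ht.1
  source t ht := ht.2.1
  isLoop :=
    { exists_infPath := hx
      returns := by
        -- A path that does not return stays in the region, where no entries are left.
        intro p hp
        by_contra! hret
        refine hinf ⟨_, _, ⟨rfl, fun i => ⟨⟨?_, fun _ hmem => ?_⟩, (hp.2 (i + 1)).2⟩⟩⟩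
        · exact (W.subTrans_entries hT (hp.2 (i + 1)).1).1
        · have := (W.subTrans_entries hT (hp.2 (i + 1)).1).2.1
          exact hL _ hmem (this.resolve_left (hret _ (Nat.succ_pos i)))
      term_subset := by
        rintro w ⟨hw, rfl | ⟨t, ht, rfl⟩⟩
        · rfl
        · rcases (W.subTrans_entries hT ht).2.2 with hr | hr
          · have := W.region_term hr
            simp_all
          · exact hr }

variable [Finite V] {start : V}

theorem weaklyGuarded (W : LoopWitness out term) :
    (chartOf V start out term).WeaklyGuarded := by
  have key : ∀ {v w : V}, Relation.TransGen (fun x y : V => (none, y) ∈ out x) v w →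
      W.rank w < W.rank v := by
    intro v w hvw
    have one : ∀ {x y : V}, (none, y) ∈ out x → W.rank y < W.rank x := fun hxy =>
      W.rank_dec hxy fun hr => W.entry_proper hxy hr rfl
    induction hvw with
    | single hxy => exact one hxy
    | tail _ hxy ih => exact (one hxy).trans ih
  intro v hv
  exact lt_irrefl _ (key hv)

/-- Elimination of the loops at the remaining heads `L`, inner ones first. Every infinite path
still uses loop-entry transitions at vertices in `L`. -/
theorem exists_layeredRun (W : LoopWitness out term) (L : List V)
    (hL : L.Pairwise fun x y => y ∉ W.region x) {T B : Set (Trans A V)}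
    (hrun : (chartOf V start out term).LayeredRun T B)
    (hT : ∀ t ∈ T, (t.2.1, t.2.2) ∈ out t.1) (hB : ∀ t ∈ B, t.1 ∉ L)
    (hinf : ¬ ∃ v p, IsInfPath {t | t ∈ T ∧ (t.2.2 ∈ W.region t.1 → t.1 ∉ L)} v p) :
    (chartOf V start out term).LLEE := by
  induction L generalizing T B with
  | nil =>
    exact ⟨T, B, hrun, fun ⟨v, p, hp⟩ => hinf ⟨v, p, hp.1, fun i =>
      ⟨⟨(hp.2 i).1, by simp⟩, (hp.2 i).2⟩⟩⟩
  | cons x L ih =>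
    rw [List.pairwise_cons] at hL
    have hL' : ∀ y ∈ x :: L, y ∉ W.region x := by
      simpa using ⟨W.notMem_region x, hL.1⟩
    by_cases hx : ∃ p, IsInfPath {t | SubTrans T x (W.entries T x) t} x p
    · have hloop := W.isLoopSubChart hT hL' hinf hx
      refine ih hL.2 (hrun.step hloop ?_) (fun t ht => hT t ht.1.1) ?_ ?_
      · refine Set.disjoint_left.2 fun t ht htB => hB t htB ?_
        simp [ht.2.1]
      · rintro t (ht | ht) hmem
        · exact hB t ht (List.mem_cons_of_mem _ hmem)
        · exact hL.1 _ hmem ((W.subTrans_entries hT ht.1).2.1.resolve_left ht.2)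
      · rintro ⟨v, p, hp⟩
        refine hinf ⟨v, p, hp.1, fun i => ⟨⟨(hp.2 i).1.1.1.1, fun hr => ?_⟩, (hp.2 i).2⟩⟩
        rw [List.mem_cons, not_or]
        refine ⟨fun hpx => (hp.2 i).1.1.1.2 ⟨(hp.2 i).1.1.1.1, hpx, hpx ▸ hr⟩, (hp.2 i).1.2 hr⟩
    · -- Without an infinite path at `x` there is nothing to eliminate: an infinite path that uses
      -- entries at `x` only would have to use them twice, and would yield a loop at `x`.
      refine ih hL.2 hrun hT (fun t ht hmem => hB t ht (List.mem_cons_of_mem _ hmem)) ?_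
      rintro ⟨v, p, hp⟩
      have hvisit : ∀ n, ∃ i, p (n + i) ∈ W.entries T x := by
        intro n
        by_contra! hno
        refine hinf ⟨_, _, rfl, fun i => ⟨⟨((hp.add n).2 i).1.1, fun hr => ?_⟩,
          ((hp.add n).2 i).2⟩⟩
        rw [List.mem_cons, not_or]
        exact ⟨fun hpx => hno i ⟨((hp.add n).2 i).1.1, hpx, hpx ▸ hr⟩,
          ((hp.add n).2 i).1.2 hr⟩
      obtain ⟨i, hi⟩ := hvisit 0
      obtain ⟨j, hj⟩ := hvisit (0 + i + 1)
      have hpT : IsInfPath T x fun k => p (0 + i + k) :=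
        ⟨hi.2.1, fun k => ⟨(hp.2 _).1.1, (hp.2 _).2⟩⟩
      exact hx (W.exists_infPath_of_return hpT hi ⟨1 + j, by omega, by
        simpa [add_assoc] using hj.2.1⟩)

theorem llee (W : LoopWitness out term) : (chartOf V start out term).LLEE := by
  refine W.exists_layeredRun W.heads W.order .init (fun t ht => ht)
    (fun t ht => absurd ht (Set.notMem_empty t)) ?_
  rintro ⟨v, p, hp⟩
  have hdec : ∀ i, W.rank (p (i + 1)).1 < W.rank (p i).1 := by
    intro i
    obtain ⟨⟨hmem, hr⟩, heq⟩ := hp.2 i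
    rw [← heq]
    exact W.rank_dec hmem fun h => hr h (W.mem_heads h)
  have : ∀ i, W.rank (p i).1 + i ≤ W.rank (p 0).1 := by
    intro i
    induction i with
    | zero => simp
    | succ i ih => have := hdec i; omega
  have := this (W.rank (p 0).1 + 1)
  omega

end LoopWitness

end Criterion

/-! ### Fragments: compositional 1-charts for star expressions -/

section Fragments

variable {A : Type u}

/-- The two-level composition of certificates: the second 1-chart is entered from terminating
vertices of the first. Loop bodies of the first contain no terminating vertices, and therefore
stay loop bodies. -/
def LoopWitness.append {V₁ V₂ : Type u} {o₁ : V₁ → List (Option A × V₁)}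
    {o₂ : V₂ → List (Option A × V₂)} {t₁ : V₁ → Bool} {t₂ : V₂ → Bool}
    (W₁ : LoopWitness o₁ t₁) (W₂ : LoopWitness o₂ t₂)
    {o : V₁ ⊕ V₂ → List (Option A × (V₁ ⊕ V₂))} {t : V₁ ⊕ V₂ → Bool}
    (hl : ∀ v l y, (l, y) ∈ o (.inl v) →
      (∃ w, y = .inl w ∧ (l, w) ∈ o₁ v) ∨ (t₁ v = true ∧ ∃ w, y = .inr w))
    (hr : ∀ v l y, (l, y) ∈ o (.inr v) → ∃ w, y = .inr w ∧ (l, w) ∈ o₂ v)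
    (htl : ∀ v, t₁ v = false → t (.inl v) = false)
    (htr : ∀ v, t₂ v = false → t (.inr v) = false) :
    LoopWitness o t where
  region := Sum.elim (fun v => Sum.inl '' W₁.region v) (fun v => Sum.inr '' W₂.region v)
  heads := W₁.heads.map Sum.inl ++ W₂.heads.map Sum.inr
  rank := Sum.elim (fun v => W₁.rank v + W₂.bound) W₂.rank
  bound := W₁.bound + W₂.bound
  mem_heads := by
    rintro (v | v) _ ⟨w, hw, rfl⟩
    · simpa using W₁.mem_heads hw
    · simpa using W₂.mem_heads hw
  entry_proper := by
    rintro (v | v) l _ h ⟨w, hw, rfl⟩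
    · obtain ⟨_, ⟨⟩, h⟩ | ⟨_, _, ⟨⟩⟩ := hl _ _ _ h
      exact W₁.entry_proper h hw
    · obtain ⟨_, ⟨⟩, h⟩ := hr _ _ _ h
      exact W₂.entry_proper h hw
  region_closed := by
    rintro (v | v) _ l y ⟨w, hw, rfl⟩ h
    · obtain ⟨z, rfl, hz⟩ | ⟨ht, _⟩ := hl _ _ _ h
      · simpa using W₁.region_closed hw hz
      · simp [W₁.region_term hw] at ht
    · obtain ⟨z, rfl, hz⟩ := hr _ _ _ h
      simpa using W₂.region_closed hw hz
  region_term := by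
    rintro (v | v) _ ⟨w, hw, rfl⟩
    · exact htl _ (W₁.region_term hw)
    · exact htr _ (W₂.region_term hw)
  notMem_region := by
    rintro (v | v)
    · simpa using W₁.notMem_region v
    · simpa using W₂.notMem_region v
  order := by
    simpa [List.pairwise_append, List.pairwise_map] using ⟨W₁.order, W₂.order⟩
  rank_lt := by
    rintro (v | v)
    · simpa using W₁.rank_lt v
    · exact (W₂.rank_lt v).trans_le (Nat.le_add_left _ _)
  rank_dec := by
    rintro (v | v) l y h hy
    · obtain ⟨w, rfl, hw⟩ | ⟨_, w, rfl⟩ := hl _ _ _ h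
      · simpa using W₁.rank_dec hw (by simpa using hy)
      · exact (W₂.rank_lt w).trans_le (Nat.le_add_left _ _)
    · obtain ⟨w, rfl, hw⟩ := hr _ _ _ h
      exact W₂.rank_dec hw (by simpa using hy)

/-- The certificate for an iteration: a new outermost head `none`, with all old vertices as its
region, is entered by 1-transitions from the terminating vertices. -/
def LoopWitness.option {V : Type u} {out : V → List (Option A × V)} {term : V → Bool}
    (W : LoopWitness out term) {o : Option V → List (Option A × Option V)} {t : Option V → Bool}
    (hs : ∀ v l y, (l, y) ∈ o (some v) →
      (∃ w, y = some w ∧ (l, w) ∈ out v) ∨ (term v = true ∧ y = none))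
    (hn : ∀ l y, (l, y) ∈ o none → l ≠ none ∧ ∃ w, y = some w)
    (ht : ∀ v, t (some v) = false) :
    LoopWitness o t where
  region := fun x => x.elim (Set.range some) fun v => some '' W.region v
  heads := W.heads.map some ++ [none]
  rank := fun x => x.elim 0 fun v => W.rank v + 1
  bound := W.bound + 1
  mem_heads := by
    rintro (_ | v) w h
    · simp
    · obtain ⟨w, hw, rfl⟩ := h
      simpa using W.mem_heads hw
  entry_proper := by
    rintro (_ | v) l w h hw
    · exact (hn _ _ h).1
    · obtain ⟨w, hw, rfl⟩ := hw
      obtain ⟨_, ⟨⟩, h⟩ | ⟨_, ⟨⟩⟩ := hs _ _ _ h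
      exact W.entry_proper h hw
  region_closed := by
    rintro (_ | v) w l y hw h
    · cases y <;> simp
    · obtain ⟨w, hw, rfl⟩ := hw
      obtain ⟨z, rfl, hz⟩ | ⟨ht, _⟩ := hs _ _ _ h
      · simpa using W.region_closed hw hz
      · simp [W.region_term hw] at ht
  region_term := by
    rintro (_ | v) w hw
    · obtain ⟨w, rfl⟩ := hw
      exact ht w
    · obtain ⟨w, hw, rfl⟩ := hw
      exact ht w
  notMem_region := by
    rintro (_ | v)
    · simp
    · simpa using W.notMem_region v
  order := by
    simpa [List.pairwise_append, List.pairwise_map] using W.order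
  rank_lt := by
    rintro (_ | v)
    · simp
    · simpa using W.rank_lt v
  rank_dec := by
    rintro (_ | v) l y h hy
    · obtain ⟨w, rfl⟩ := (hn _ _ h).2
      simp at hy
    · obtain ⟨w, rfl, hw⟩ | ⟨_, rfl⟩ := hs _ _ _ h
      · simpa using W.rank_dec hw (by simpa using hy)
      · simp

/-- A certificate for a 1-chart without transitions. -/
def LoopWitness.trivial {V : Type u} (term : V → Bool) :
    LoopWitness (A := A) (fun _ => []) term where
  region _ := ∅
  heads := []
  rank _ := 0
  bound := 1
  mem_heads := by simp
  entry_proper := by simp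
  region_closed := by simp
  region_term := by simp
  notMem_region := by simp
  order := .nil
  rank_lt := by simp
  rank_dec := by simp

/-- A 1-chart without its start vertex: the proper transitions `init` that depart from the start,
whether the start has immediate termination, and the 1-chart on the vertices that are reached after
at least one step, together with a certificate for `LLEE`. -/
structure Frag (A V : Type u) : Type u where
  init : List (Option A × V)
  init_proper : ∀ x ∈ init, x.1 ≠ none
  halt : Bool
  out : V → List (Option A × V)
  term : V → Bool
  wit : LoopWitness out term

namespace Frag

variable {V W : Type u}

/-- A fragment without transitions. -/
def const (A : Type u) (b : Bool) : Frag A PEmpty.{u + 1} where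
  init := []
  init_proper := by simp
  halt := b
  out := fun _ => []
  term := fun _ => false
  wit := .trivial _

def act (a : A) : Frag A PUnit.{u + 1} where
  init := [(some a, ⟨⟩)]
  init_proper := by simp
  halt := false
  out := fun _ => []
  term := fun _ => true
  wit := .trivial _

def sum (F : Frag A V) (G : Frag A W) : Frag A (V ⊕ W) where
  init := F.init.map (Prod.map id .inl) ++ G.init.map (Prod.map id .inr)
  init_proper := by
    have := F.init_proper
    have := G.init_proper
    simp
    grind
  halt := F.halt || G.halt
  out := Sum.elim (fun v => (F.out v).map (Prod.map id .inl))
    (fun v => (G.out v).map (Prod.map id .inr))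
  term := Sum.elim F.term G.term
  wit := F.wit.append G.wit (by simp) (by simp) (by simp) (by simp)

/-- In a product, terminating vertices of the first factor have the initial transitions of the
second factor. -/
def prod (F : Frag A V) (G : Frag A W) : Frag A (V ⊕ W) where
  init := F.init.map (Prod.map id .inl) ++
    if F.halt then G.init.map (Prod.map id .inr) else []
  init_proper := by
    have := F.init_proper
    have := G.init_proper
    simp
    grind
  halt := F.halt && G.halt
  out := Sum.elim
    (fun v => (F.out v).map (Prod.map id .inl) ++
      if F.term v then G.init.map (Prod.map id .inr) else [])
    (fun v => (G.out v).map (Prod.map id .inr))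
  term := Sum.elim (fun v => F.term v && G.halt) G.term
  wit := F.wit.append G.wit (by simp; grind) (by simp) (by simp +contextual) (by simp)

/-- In an iteration, terminating vertices of the body lose their termination, and get a
1-transition to a new vertex `none` that behaves like the iteration itself. -/
def star (F : Frag A V) : Frag A (Option V) where
  init := F.init.map (Prod.map id some)
  init_proper := by
    have := F.init_proper
    simp
    grind
  halt := true
  out := fun x => x.elim (F.init.map (Prod.map id some))
    fun v => (F.out v).map (Prod.map id some) ++ if F.term v then [(none, none)] else []
  term := Option.isNone
  wit := F.wit.option (by simp; grind)
    (by have := F.init_proper; simp; grind) (by simp)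

/-- The certificate for the 1-chart of a fragment. The start vertex has no incoming transitions. -/
def chartWitness (F : Frag A V) : LoopWitness (V := PUnit.{u + 1} ⊕ V)
    (Sum.elim (fun _ => F.init.map (Prod.map id .inr)) fun v => (F.out v).map (Prod.map id .inr))
    (Sum.elim (fun _ => F.halt) F.term) :=
  (LoopWitness.trivial fun _ => true).append F.wit (by simp) (by simp) (by simp) (by simp)

/-- The 1-chart of a fragment, with its start vertex added. -/
def chart [Finite V] (F : Frag A V) : OneChart A :=
  chartOf (PUnit.{u + 1} ⊕ V) (.inl ⟨⟩)
    (Sum.elim (fun _ => F.init.map (Prod.map id .inr)) fun v => (F.out v).map (Prod.map id .inr))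
    (Sum.elim (fun _ => F.halt) F.term)

theorem chart_llee [Finite V] (F : Frag A V) : F.chart.LLEE := F.chartWitness.llee

theorem chart_weaklyGuarded [Finite V] (F : Frag A V) : F.chart.WeaklyGuarded :=
  F.chartWitness.weaklyGuarded

/-! ### Solutions of fragments -/

variable {S : ProofSystem A} {h : ExtendsMilMinus S}

/-- The assignment `s` to the vertices satisfies the equations of the fragment, and the start
equation holds for `X`. -/
structure Sol (h : ExtendsMilMinus S) (F : Frag A V) (X : StExp A) (s : V → StExp A) : Prop where
  init : cls h X = (if F.halt then 1 else 0) + lin (fun v => cls h (s v)) F.init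
  step : ∀ v, cls h (s v) = (if F.term v then 1 else 0) + lin (fun w => cls h (s w)) (F.out v)

theorem Sol.isSolution [Finite V] {F : Frag A V} {X : StExp A} {s : V → StExp A}
    (hs : Sol h F X s) : F.chart.IsSolution S (Sum.elim (fun _ => X) s) := by
  refine (isSolution_iff h).2 ?_
  rintro (v | v)
  · refine ⟨F.init.map (Prod.map id .inr), fun x => Iff.rfl, ?_⟩
    refine hs.init.trans (congrArg₂ _ ?_
      (lin_map (fun w => cls h (Sum.elim (fun _ => X) s w)) .inr _).symm)
    congr
  · refine ⟨(F.out v).map (Prod.map id .inr), fun x => Iff.rfl, ?_⟩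
    refine (hs.step v).trans (congrArg₂ _ ?_
      (lin_map (fun w => cls h (Sum.elim (fun _ => X) s w)) .inr _).symm)
    congr

variable {F : Frag A V} {G : Frag A W} {X Y : StExp A} {s : V → StExp A} {t : W → StExp A}

theorem Sol.sum (hs : Sol h F X s) (ht : Sol h G Y t) :
    Sol h (F.sum G) (.sum X Y) (Sum.elim s t) where
  init := by
    rw [cls_sum, hs.init, ht.init]
    simp only [Frag.sum, lin_append, lin_map, Sum.elim_inl, Sum.elim_inr]
    rw [add_add_add_comm]
    congr 1
    by_cases hF : F.halt = true <;> by_cases hG : G.halt = true <;>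
      simp [hF, hG, ProvQuot.add_self]
  step := by
    rintro (v | v)
    · simp only [Frag.sum, lin_map, Sum.elim_inl]
      exact hs.step v
    · simp only [Frag.sum, lin_map, Sum.elim_inr]
      exact ht.step v

theorem Sol.prod (hs : Sol h F X s) (ht : Sol h G Y t) :
    Sol h (F.prod G) (.prod X Y) (Sum.elim (fun v => .prod (s v) Y) t) where
  init := by
    rw [cls_prod, hs.init, add_mul, lin_mul]
    simp only [Frag.prod, lin_append, lin_map, Sum.elim_inl, cls_prod]
    by_cases hF : F.halt = true
    · simp [hF, lin_map, ht.init]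
      abel
    · simp [hF, ProvQuot.zero_mul, lin_nil]
  step := by
    rintro (v | v)
    · simp only [Frag.prod, lin_append, lin_map, Sum.elim_inl, cls_prod]
      rw [hs.step v, add_mul, lin_mul]
      by_cases hF : F.term v = true
      · simp [hF, lin_map, ht.init]
        abel
      · simp [hF, ProvQuot.zero_mul, lin_nil]
    · simp only [Frag.prod, lin_map, Sum.elim_inr]
      exact ht.step v

theorem Sol.star (hs : Sol h F X s) :
    Sol h F.star (.star X) fun x => x.elim (.star X) fun v => .prod (s v) (.star X) := by
  have key : cls h (.star X) = 1 + lin (fun v => cls h (s v) * cls h (.star X)) F.init := by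
    have hX : cls h X = (if F.halt then 1 else 0) + cls h (StExp.sumList
        (F.init.map fun x => .prod (labelExp x.1) (s x.2))) := by
      rw [cls_sumList_lin, hs.init]
    have := cls_star_eq_of_body hX
    rwa [cls_sumList_lin, lin_mul] at this
  constructor
  · simpa [Frag.star, lin_map, cls_prod] using key
  · rintro (_ | v)
    · simpa [Frag.star, lin_map, cls_prod] using key
    · simp only [Frag.star, lin_append, lin_map, Option.elim_some, cls_prod]
      rw [hs.step v, add_mul, lin_mul]
      by_cases hF : F.term v = true
      · simp [hF, lin, labelExp, cls_one, add_comm]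
      · simp [hF, ProvQuot.zero_mul, lin_nil]

/-- A solution of the fragment of `f* · g` that starts with an arbitrary `X` for which
`X = f · X + g` is provable: each occurrence of `f* · g` in the canonical solution is replaced
by `X`. -/
theorem Sol.star_prod {f g : StExp A} (hs : Sol h F f s) (ht : Sol h G g t)
    (hF : F.halt = false) (hX : cls h X = cls h f * cls h X + cls h g) :
    Sol h (F.star.prod G) X (Sum.elim (fun x => x.elim X fun v => .prod (s v) X) t) := by
  have key : cls h X = (if G.halt then 1 else 0) +
      (lin (fun v => cls h (s v) * cls h X) F.init + lin (fun v => cls h (t v)) G.init) := by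
    have hf : cls h f = lin (fun v => cls h (s v)) F.init := by simpa [hF] using hs.init
    rwa [hf, lin_mul, ht.init, add_left_comm] at hX
  constructor
  · simpa [Frag.prod, Frag.star, lin_append, lin_map, cls_prod, -List.map_map] using key
  · rintro ((_ | v) | v)
    · simpa [Frag.prod, Frag.star, lin_append, lin_map, cls_prod, -List.map_map] using key
    · simp only [Frag.prod, Frag.star, lin_append, lin_map, Sum.elim_inl, Option.elim_some,
        cls_prod]
      rw [hs.step v, add_mul, lin_mul]
      by_cases hF : F.term v = true
      · simp [hF, lin, labelExp, cls_one, add_comm]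
      · simp [hF, ProvQuot.zero_mul, lin_nil]
    · simp only [Frag.prod, lin_map, Sum.elim_inr]
      exact ht.step v

/-- Every star expression is provably a solution of some fragment, at whose start immediate
termination is sound. -/
theorem exists_sol (h : ExtendsMilMinus S) (e : StExp A) :
    ∃ (V : Type u) (_ : Finite V) (F : Frag A V) (s : V → StExp A),
      Sol h F e s ∧ (F.halt = true → e.Terminates) := by
  induction e with
  | zero =>
    exact ⟨_, inferInstance, const A false, fun v => v.elim,
      ⟨by simp [const, lin, cls_zero], fun v => v.elim⟩, fun h => nomatch h⟩
  | one =>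
    exact ⟨_, inferInstance, const A true, fun v => v.elim,
      ⟨by simp [const, lin, cls_one], fun v => v.elim⟩, fun _ => .one⟩
  | act a =>
    exact ⟨_, inferInstance, act a, fun _ => .one, ⟨by simp [act, lin, cls_one, labelExp],
      fun v => by simp [act, lin, cls_one]⟩, fun h => nomatch h⟩
  | sum e f ihe ihf =>
    obtain ⟨V, _, F, s, hs, hF⟩ := ihe
    obtain ⟨W, _, G, t, ht, hG⟩ := ihf
    refine ⟨_, inferInstance, F.sum G, _, hs.sum ht, fun hh => ?_⟩
    exact (Bool.or_eq_true_iff.1 hh).elim (fun h => .sumL (hF h)) fun h => .sumR (hG h)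
  | prod e f ihe ihf =>
    obtain ⟨V, _, F, s, hs, hF⟩ := ihe
    obtain ⟨W, _, G, t, ht, hG⟩ := ihf
    refine ⟨_, inferInstance, F.prod G, _, hs.prod ht, fun hh => ?_⟩
    exact .prod (hF (Bool.and_eq_true_iff.1 hh).1) (hG (Bool.and_eq_true_iff.1 hh).2)
  | star e ihe =>
    obtain ⟨V, _, F, s, hs, hF⟩ := ihe
    exact ⟨_, inferInstance, F.star, _, hs.star, fun _ => .star e⟩

/-- If a fragment has solutions that start with `X` and with `Y`, then `X = Y` has an
`LLEE`-witnessed coinductive proof. -/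
theorem exists_coindProof [Finite V] {s' : V → StExp A} (hs : Sol h F X s) (hs' : Sol h F Y s') :
    ∃ P : CoindProof S ⟨X, Y⟩, P.LLEEWitnessed :=
  ⟨{ chart := F.chart
     weaklyGuarded := F.chart_weaklyGuarded
     label := fun v => ⟨Sum.elim (fun _ => X) s v, Sum.elim (fun _ => Y) s' v⟩
     solution_lhs := hs.isSolution
     solution_rhs := hs'.isSolution
     label_start := rfl }, F.chart_llee⟩

end Frag

end Fragments

/-! ### Unique solvability of `LLEE`-1-charts in Milner's system -/

section Unique

variable {A : Type u}

theorem mil_extends (A : Type u) : ExtendsMilMinus (Mil A) where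
  ax h := .ax h
  el h := .rule (.inl h)

theorem milMinus_addAxioms_extends (A : Type u) (Γ : Set (StExpEq A)) :
    ExtendsMilMinus ((MilMinus A).addAxioms Γ) where
  ax h := .ax (.inl h)
  el h := .rule h

/-- Equality of star expressions modulo provability in Milner's system. -/
local notation "⟦" e "⟧ₘ" => cls (mil_extends _) e

theorem mil_rsp {e f g : StExp A} (hf : ¬ f.Terminates) (h : ⟦e⟧ₘ = ⟦f⟧ₘ * ⟦e⟧ₘ + ⟦g⟧ₘ) :
    ⟦e⟧ₘ = ⟦.star f⟧ₘ * ⟦g⟧ₘ := by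
  rw [← cls_prod, cls_eq_iff]
  refine .rule (.inr (.mk e f g hf)) ?_
  simpa using cls_eq_iff.1 h

theorem terminates_sumList {l : List (StExp A)} (h : (StExp.sumList l).Terminates) :
    ∃ e ∈ l, e.Terminates := by
  have key : ∀ (l : List (StExp A)) (e : StExp A), (l.foldl StExp.sum e).Terminates →
      ∃ f ∈ e :: l, f.Terminates := by
    intro l
    induction l with
    | nil => exact fun e h => ⟨e, by simp, h⟩
    | cons f l ih =>
      intro e h
      obtain ⟨g, hg, hgt⟩ := ih _ h
      rcases List.mem_cons.1 hg with rfl | hg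
      · cases hgt with
        | sumL h => exact ⟨e, by simp, h⟩
        | sumR h => exact ⟨f, by simp, h⟩
      · exact ⟨g, by simp [hg], hgt⟩
  cases l with
  | nil => cases h
  | cons e l => exact key l e h

theorem exists_of_terminates_sumList_label {ι : Type*} {l : List ι} {a : ι → Option A}
    {s : ι → StExp A}
    (h : (StExp.sumList (l.map fun x => .prod (labelExp (a x)) (s x))).Terminates) :
    ∃ x ∈ l, a x = none ∧ (s x).Terminates := by
  obtain ⟨e, he, ht⟩ := terminates_sumList h
  obtain ⟨x, hx, rfl⟩ := List.mem_map.1 he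
  cases ht with
  | prod h1 h2 =>
    refine ⟨x, hx, ?_, h2⟩
    cases hax : a x with
    | none => rfl
    | some b => rw [hax] at h1; cases h1

/-- Within a loop sub-1-chart at `v`, there is no infinite path that avoids `v`. -/
theorem acc_of_subTrans {V : Type u} {T : Set (Trans A V)} {F : Set V} {v : V}
    {U : Set (Trans A V)} (hU : IsLoopSubChart T F v U) {t : Trans A V} (ht : SubTrans T v U t) :
    Acc (fun t' t : Trans A V => SubTrans T v U t ∧ t.2.2 ≠ v ∧ t' ∈ T ∧ t'.1 = t.2.2) t := by
  induction ht with
  | @entry t ht =>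
    by_contra hacc
    obtain ⟨p, rfl, hp⟩ := not_acc_iff_exists_descending_chain.1 hacc
    obtain ⟨n, hn, hnv⟩ := hU.isLoop.returns p
      ⟨hU.source _ ht, fun i => ⟨(hp i).1, (hp i).2.2.2.symm⟩⟩
    obtain ⟨m, rfl⟩ := Nat.exists_eq_succ_of_ne_zero hn.ne'
    exact (hp m).2.1 ((hp m).2.2.2.symm.trans hnv)
  | step h hne hT heq ih => exact ih.inv ⟨h, hne, hT, heq⟩

variable {C : OneChart A}

/-- The intermediate form of the solutions of `C` during loop elimination: for the vertices
reachable in the current transition set `T`, any solution `s` satisfies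
`s x = d x · s x + (τ x + Σ_T l · s y)`, where the non-terminating expressions `d x` arise from
the eliminated loops at `x` and do not depend on `s`. -/
def IsLoopSolvedBy (C : OneChart A) (T : Set (Trans A C.V)) (d : C.V → StExp A) : Prop :=
  ∀ s, C.IsSolution (Mil A) s → ∀ x, Reachable T C.start x → ∀ l : List (Option A × C.V),
    (∀ y, y ∈ l ↔ (x, y.1, y.2) ∈ T) →
      ⟦s x⟧ₘ = ⟦d x⟧ₘ * ⟦s x⟧ₘ + (⟦C.termConst x⟧ₘ + lin (fun w => ⟦s w⟧ₘ) l)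

theorem exists_list_of_subset (hfin : ∀ v, ∃ l : List (Option A × C.V),
    ∀ y, y ∈ l ↔ (v, y.1, y.2) ∈ C.trans) {T : Set (Trans A C.V)} (hT : T ⊆ C.trans) (v : C.V) :
    ∃ l : List (Option A × C.V), ∀ y, y ∈ l ↔ (v, y.1, y.2) ∈ T := by
  classical
  obtain ⟨l, hl⟩ := hfin v
  refine ⟨l.filter fun y => (v, y.1, y.2) ∈ T, fun y => ?_⟩
  simp only [List.mem_filter, hl, decide_eq_true_eq, and_iff_right_iff_imp]
  exact fun h => hT h

theorem Reachable.tail {V : Type u} {T : Set (Trans A V)} {s x y : V} {l : Option A}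
    (h : Reachable T s x) (hxy : (x, l, y) ∈ T) : Reachable T s y :=
  Relation.ReflTransGen.tail h ⟨l, hxy⟩

theorem Reachable.mono {V : Type u} {T T' : Set (Trans A V)} (hT : T ⊆ T') {s x : V}
    (h : Reachable T s x) : Reachable T' s x :=
  Relation.ReflTransGen.mono (fun _ _ (h : ∃ _, _) => h.imp fun _ hl => hT hl) _ _ h

/-- Solutions at the targets `w` of transitions of a loop sub-1-chart at `v` are determined by the
solution at `v`: they have the form `e · s v`, where `e` is independent of `s`, and terminates only
if `v` can be reached from `w` by 1-transitions. -/
theorem exists_exp_of_subTrans (hfin : ∀ v, ∃ l : List (Option A × C.V),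
    ∀ y, y ∈ l ↔ (v, y.1, y.2) ∈ C.trans) {T U : Set (Trans A C.V)} (hT : T ⊆ C.trans)
    {d : C.V → StExp A} (hd : ∀ x, ¬ (d x).Terminates) (hsol : IsLoopSolvedBy C T d) {v : C.V}
    (hU : IsLoopSubChart T C.term v U) (hv : Reachable T C.start v)
    {t : Trans A C.V} (ht : SubTrans T v U t) :
    ∃ e : StExp A,
      (e.Terminates → Relation.ReflTransGen (fun x y => (x, none, y) ∈ C.trans) t.2.2 v) ∧
      ∀ s, C.IsSolution (Mil A) s → ⟦s t.2.2⟧ₘ = ⟦e⟧ₘ * ⟦s v⟧ₘ := by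
  have hreach : ∀ {t}, SubTrans T v U t → Reachable T C.start t.2.2 := by
    intro t ht
    induction ht with
    | @entry t ht =>
      have h1 := hU.source t ht
      exact hv.tail (l := t.2.1) (h1 ▸ hU.subset ht)
    | @step t t' _ _ ht' heq ih => exact (heq ▸ ih).tail (l := t'.2.1) ht'
  induction acc_of_subTrans hU ht with
  | intro t _ ih =>
    by_cases hw : t.2.2 = v
    · exact ⟨.one, fun _ => hw ▸ .refl, fun s _ => by rw [hw, cls_one, one_mul]⟩
    · obtain ⟨l, hl⟩ := exists_list_of_subset hfin hT t.2.2
      have hnext : ∀ y : Option A × C.V, ∃ e : StExp A, y ∈ l →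
          (e.Terminates → Relation.ReflTransGen (fun x y => (x, none, y) ∈ C.trans) y.2 v) ∧
          ∀ s, C.IsSolution (Mil A) s → ⟦s y.2⟧ₘ = ⟦e⟧ₘ * ⟦s v⟧ₘ := by
        intro y
        by_cases hy : y ∈ l
        · have hyT := (hl y).1 hy
          obtain ⟨e, he⟩ := ih (t.2.2, y.1, y.2) ⟨ht, hw, hyT, rfl⟩ (.step ht hw hyT rfl)
          exact ⟨e, fun _ => he⟩
        · exact ⟨.zero, fun h => absurd h hy⟩
      choose e he using hnext
      refine ⟨.prod (.star (d t.2.2))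
        (StExp.sumList (l.map fun y => .prod (labelExp y.1) (e y))), fun hterm => ?_, ?_⟩
      · cases hterm with
        | prod _ hterm =>
          obtain ⟨y, hy, hy1, hyt⟩ := exists_of_terminates_sumList_label hterm
          refine .head ?_ ((he y hy).1 hyt)
          rw [← hy1]
          exact hT ((hl y).1 hy)
      · intro s hs
        have hnt : t.2.2 ∉ C.term := fun hF =>
          hw (hU.isLoop.term_subset ⟨hF, .inr ⟨t, ht, rfl⟩⟩)
        have hlin : lin (fun w => ⟦s w⟧ₘ) l =
            ⟦StExp.sumList (l.map fun y => .prod (labelExp y.1) (e y))⟧ₘ * ⟦s v⟧ₘ := by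
          rw [cls_sumList_label, ProvQuot.list_sum_mul, lin]
          refine congrArg List.sum (List.map_congr_left fun y hy => ?_)
          rw [(he y hy).2 s hs, mul_assoc]
        have heq := hsol s hs _ (hreach ht) l hl
        have hτ : C.termConst t.2.2 = .zero := if_neg hnt
        rw [hτ, cls_zero, zero_add, hlin, ← cls_prod _ (s v)] at heq
        rw [mil_rsp (hd _) heq, cls_prod, cls_prod, mul_assoc]

/-- Each loop elimination at `v` adds the body of the eliminated loops to the expression `d v`, and
leaves `d` unchanged elsewhere. The bodies do not terminate, because of weak guardedness. -/
theorem exists_isLoopSolvedBy (hwg : C.WeaklyGuarded)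
    (hfin : ∀ v, ∃ l : List (Option A × C.V), ∀ y, y ∈ l ↔ (v, y.1, y.2) ∈ C.trans)
    {T B : Set (Trans A C.V)} (hrun : C.LayeredRun T B) :
    T ⊆ C.trans ∧ ∃ d : C.V → StExp A, (∀ x, ¬ (d x).Terminates) ∧ IsLoopSolvedBy C T d := by
  classical
  induction hrun with
  | init =>
    refine ⟨subset_rfl, fun _ => .zero, (fun _ h => nomatch h), fun s hs x _ l hl => ?_⟩
    obtain ⟨l', hl', heq⟩ := (isSolution_iff (mil_extends A)).1 hs x
    have hτ : ⟦C.termConst x⟧ₘ = if x ∈ C.term then 1 else 0 := by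
      unfold OneChart.termConst
      split_ifs <;> rfl
    rw [cls_zero, ProvQuot.zero_mul, zero_add, hτ,
      lin_congr _ fun y => (hl y).trans (hl' y).symm]
    exact heq
  | @step T B U v _ hU _ ih =>
    obtain ⟨hT, d, hd, hsol⟩ := ih
    have hsub : eliminate C.start T U ⊆ T \ U := fun t ht => ht.1
    refine ⟨fun t ht => hT (hsub ht).1, ?_⟩
    have hT' : ∀ {x}, Reachable (eliminate C.start T U) C.start x → ∀ {y : Option A × C.V},
        (x, y.1, y.2) ∈ eliminate C.start T U ↔ (x, y.1, y.2) ∈ T \ U := fun hx y =>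
      ⟨fun h => hsub h, fun h => ⟨h, fun _ => hx.mono hsub⟩⟩
    have hsame : ∀ s, C.IsSolution (Mil A) s → ∀ x, x ≠ v →
        Reachable (eliminate C.start T U) C.start x → ∀ l : List (Option A × C.V),
        (∀ y, y ∈ l ↔ (x, y.1, y.2) ∈ eliminate C.start T U) →
        ⟦s x⟧ₘ = ⟦d x⟧ₘ * ⟦s x⟧ₘ + (⟦C.termConst x⟧ₘ + lin (fun w => ⟦s w⟧ₘ) l) := by
      intro s hs x hxv hx l hl
      refine hsol s hs x (hx.mono fun t ht => (hsub ht).1) l fun y => ?_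
      rw [hl, hT' hx]
      exact ⟨fun h => h.1, fun h => ⟨h, fun hyU => hxv (hU.source _ hyU)⟩⟩
    by_cases hv : Reachable T C.start v
    · obtain ⟨lU, hlU⟩ := exists_list_of_subset hfin (hU.subset.trans hT) v
      have hnext : ∀ y : Option A × C.V, ∃ e : StExp A, y ∈ lU →
          (e.Terminates → Relation.ReflTransGen (fun x y => (x, none, y) ∈ C.trans) y.2 v) ∧
          ∀ s, C.IsSolution (Mil A) s → ⟦s y.2⟧ₘ = ⟦e⟧ₘ * ⟦s v⟧ₘ := by
        intro y
        by_cases hy : y ∈ lU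
        · obtain ⟨e, he⟩ := exists_exp_of_subTrans hfin hT hd hsol hU hv (.entry ((hlU y).1 hy))
          exact ⟨e, fun _ => he⟩
        · exact ⟨.zero, fun h => absurd h hy⟩
      choose e he using hnext
      refine ⟨Function.update d v (.sum (d v)
        (StExp.sumList (lU.map fun y => .prod (labelExp y.1) (e y)))), fun x => ?_, ?_⟩
      · by_cases hx : x = v
        · subst hx
          rw [Function.update_self]
          intro hterm
          cases hterm with
          | sumL h => exact hd x h
          | sumR h =>
            -- A terminating loop body would contain a cycle of 1-transitions.
            obtain ⟨y, hy, hy1, hyt⟩ := exists_of_terminates_sumList_label h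
            refine hwg x (.head' ?_ ((he y hy).1 hyt))
            rw [← hy1]
            exact hT (hU.subset ((hlU y).1 hy))
        · rw [Function.update_of_ne hx]
          exact hd x
      · intro s hs x hx l hl
        by_cases hxv : x = v
        · subst hxv
          have heq := hsol s hs x hv (lU ++ l) fun y => by
            rw [List.mem_append, hlU, hl, hT' hx, Set.mem_sdiff]
            have : (x, y.1, y.2) ∈ U → (x, y.1, y.2) ∈ T := fun h => hU.subset h
            tauto
          have hlin : lin (fun w => ⟦s w⟧ₘ) lU =
              ⟦StExp.sumList (lU.map fun y => .prod (labelExp y.1) (e y))⟧ₘ * ⟦s x⟧ₘ := by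
            rw [cls_sumList_label, ProvQuot.list_sum_mul, lin]
            refine congrArg List.sum (List.map_congr_left fun y hy => ?_)
            rw [(he y hy).2 s hs, mul_assoc]
          rw [lin_append, hlin] at heq
          rw [Function.update_self, cls_sum, add_mul]
          exact heq.trans (by abel)
        · rw [Function.update_of_ne hxv]
          exact hsame s hs x hxv hx l hl
    · refine ⟨d, hd, fun s hs x hx l hl => hsame s hs x ?_ hx l hl⟩
      rintro rfl
      exact hv (hx.mono fun t ht => (hsub ht).1)

/-- Any two solutions of a weakly guarded `LLEE`-1-chart are provably equal in Milner's system at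
the start vertex. -/
theorem solution_unique (hwg : C.WeaklyGuarded) (hllee : C.LLEE) {s₁ s₂ : C.V → StExp A}
    (h₁ : C.IsSolution (Mil A) s₁) (h₂ : C.IsSolution (Mil A) s₂) :
    (Mil A).Derivable ⟨s₁ C.start, s₂ C.start⟩ := by
  obtain ⟨T, B, hrun, hinf⟩ := hllee
  have hfin : ∀ v, ∃ l : List (Option A × C.V), ∀ y, y ∈ l ↔ (v, y.1, y.2) ∈ C.trans :=
    fun v => (h₁ v).imp fun _ hl => hl.1
  obtain ⟨hT, d, hd, hsol⟩ := exists_isLoopSolvedBy hwg hfin hrun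
  have hacc : ∀ x, Acc (fun y x => ∃ l, (x, l, y) ∈ T) x := by
    intro x
    by_contra hx
    obtain ⟨p, rfl, hp⟩ := not_acc_iff_exists_descending_chain.1 hx
    choose l hl using hp
    exact hinf ⟨p 0, fun i => (p i, l i, p (i + 1)), rfl, fun i => ⟨hl i, rfl⟩⟩
  have key : ∀ x, Reachable T C.start x → ⟦s₁ x⟧ₘ = ⟦s₂ x⟧ₘ := by
    intro x
    induction hacc x with
    | intro x _ ih =>
      intro hx
      obtain ⟨l, hl⟩ := exists_list_of_subset hfin hT x
      have solve : ∀ s, C.IsSolution (Mil A) s → ⟦s x⟧ₘ =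
          ⟦.star (d x)⟧ₘ * (⟦C.termConst x⟧ₘ + lin (fun w => ⟦s w⟧ₘ) l) := by
        intro s hs
        have heq := hsol s hs x hx l hl
        rw [← cls_sumList_lin, ← cls_sum] at heq ⊢
        exact mil_rsp (hd x) heq
      rw [solve _ h₁, solve _ h₂]
      congr 2
      refine congrArg List.sum (List.map_congr_left fun y hy => ?_)
      have hyT := (hl y).1 hy
      exact congrArg _ (ih y.2 ⟨y.1, hyT⟩ (hx.tail hyT))
  exact cls_eq_iff.1 (key C.start .refl)

end Unique

/-! ### Relating the proof systems -/

section Systems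

variable {A : Type u}

theorem derivable_mono {S S' : ProofSystem A} (hax : ∀ q ∈ S.axioms, S'.Derivable q)
    (hrule : ∀ ps q, S.rule ps q → (∀ p ∈ ps, S'.Derivable p) → S'.Derivable q)
    {q : StExpEq A} (hq : S.Derivable q) : S'.Derivable q := by
  induction hq with
  | ax h => exact hax _ h
  | rule h _ ih => exact hrule _ _ h ih

theorem OneChart.IsSolution.mono {S S' : ProofSystem A} {C : OneChart A} {s : C.V → StExp A}
    (hs : C.IsSolution S s) (h : ∀ q, S.Derivable q → S'.Derivable q) : C.IsSolution S' s :=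
  fun v => (hs v).imp fun _ hl => ⟨hl.1, h _ hl.2⟩

/-- Every equation that is derivable in an extension of `Mil⁻` has an `LLEE`-witnessed coinductive
proof over it: in the canonical solution that starts with `e`, its value at the start vertex can
be exchanged for a provably equal expression `f`, as the start vertex has no incoming
transitions. -/
theorem exists_coindProof_of_derivable {S : ProofSystem A} (h : ExtendsMilMinus S)
    {q : StExpEq A} (hq : S.Derivable q) : ∃ P : CoindProof S q, P.LLEEWitnessed := by
  obtain ⟨V, _, F, s, hs, -⟩ := Frag.exists_sol h q.lhs
  exact Frag.exists_coindProof hs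
    (⟨(cls_eq_iff.2 hq).symm.trans hs.init, hs.step⟩ : Frag.Sol h F q.rhs s)

/-- An instance of `RSP*` is an instance of `LCoindProof₁`: with the premise `e = f · e + g` as an
axiom, both `e` and `f* · g` start a solution of the 1-chart of `f* · g`. -/
theorem lCoindProof_of_rspStar {ps : List (StExpEq A)} {q : StExpEq A} (hq : RSPStar ps q) :
    LCoindProof 1 ps q := by
  obtain ⟨e, f, g, hf⟩ := hq
  have h := milMinus_addAxioms_extends A {p | p ∈ [(⟨e, .sum (.prod f e) g⟩ : StExpEq A)]}
  obtain ⟨V, _, F, s, hs, hF⟩ := Frag.exists_sol h f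
  obtain ⟨W, _, G, t, ht, -⟩ := Frag.exists_sol h g
  have hF' : F.halt = false := by
    cases hh : F.halt
    · rfl
    · exact absurd (hF hh) hf
  refine ⟨rfl, Frag.exists_coindProof (hs.star_prod ht hF' ?_) (hs.star_prod ht hF' ?_)⟩
  · rw [← cls_prod, ← cls_sum, cls_eq_iff]
    exact .ax (.inr (List.mem_singleton.2 rfl))
  · conv_lhs => rw [cls_prod, cls_star, add_mul, one_mul, mul_assoc, add_comm]
    rw [cls_prod]

/-- Soundness of the coinductive rules for Milner's system: the two solutions of an
`LLEE`-witnessed coinductive proof are provably equal. -/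
theorem mil_derivable_of_lCoindProof {n : ℕ} {ps : List (StExpEq A)} {q : StExpEq A}
    (hq : LCoindProof n ps q) (hps : ∀ p ∈ ps, (Mil A).Derivable p) : (Mil A).Derivable q := by
  obtain ⟨-, P, hP⟩ := hq
  have hmono : ∀ r, ((MilMinus A).addAxioms {p | p ∈ ps}).Derivable r → (Mil A).Derivable r :=
    fun r => derivable_mono (S := (MilMinus A).addAxioms {p | p ∈ ps})
      (fun r (hr : MilAxiom r ∨ r ∈ ps) => hr.elim (fun h => (mil_extends A).ax h) (hps r))
      fun _ _ hr hp => (mil_extends A).el hr hp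
  have := solution_unique P.weaklyGuarded hP (P.solution_lhs.mono hmono)
    (P.solution_rhs.mono hmono)
  rwa [P.label_start] at this

theorem cMil1_of_mil {q : StExpEq A} (hq : (Mil A).Derivable q) : (CMil1 A).Derivable q :=
  derivable_mono (S := Mil A) (S' := CMil1 A) (fun _ h => .ax h)
    (fun _ _ hr hp => .rule (Or.imp id lCoindProof_of_rspStar hr) hp) hq

theorem cMil_of_cMil1 {q : StExpEq A} (hq : (CMil1 A).Derivable q) : (CMil A).Derivable q :=
  derivable_mono (S := CMil1 A) (S' := CMil A) (fun _ h => .ax h)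
    (fun _ _ hr hp => .rule (Or.imp id (fun h => ⟨1, h⟩) hr) hp) hq

theorem mil_of_cMil {q : StExpEq A} (hq : (CMil A).Derivable q) : (Mil A).Derivable q :=
  derivable_mono (S := CMil A) (S' := Mil A) (fun _ h => .ax h)
    (fun _ _ hr hp => Or.elim hr ((mil_extends A).el · hp)
      fun ⟨_, h⟩ => mil_derivable_of_lCoindProof h hp) hq

theorem clc_of_cMil {q : StExpEq A} (hq : (CMil A).Derivable q) : (CLC A).Derivable q := by
  refine derivable_mono (S := CMil A) (S' := CLC A) (fun q h => ?_)
    (fun ps q hr hp => .rule ?_ hp) hq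
  · exact .rule (ps := []) ⟨0, rfl, exists_coindProof_of_derivable
      (milMinus_addAxioms_extends A _) (.ax (.inl h))⟩ (by simp)
  · exact Or.elim hr (fun h => ⟨_, rfl, exists_coindProof_of_derivable
      (milMinus_addAxioms_extends A _) (.rule h fun p hp => .ax (.inr hp))⟩) id

theorem cMil_of_clc {q : StExpEq A} (hq : (CLC A).Derivable q) : (CMil A).Derivable q :=
  derivable_mono (S := CLC A) (S' := CMil A) (fun _ h => absurd h (Set.notMem_empty _))
    (fun _ _ hr hp => .rule (Or.inr hr) hp) hq

end Systems

end StarProof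

theorem mainTheorem1 (A : Type*) :
    StarProof.ThmEquiv (StarProof.Mil A) (StarProof.CMil1 A) ∧
    StarProof.ThmEquiv (StarProof.CMil1 A) (StarProof.CMil A) ∧
    StarProof.ThmEquiv (StarProof.CMil A) (StarProof.CLC A) :=
  ⟨fun _ => ⟨StarProof.cMil1_of_mil, fun h => StarProof.mil_of_cMil (StarProof.cMil_of_cMil1 h)⟩,
    fun _ => ⟨StarProof.cMil_of_cMil1, fun h => StarProof.cMil1_of_mil (StarProof.mil_of_cMil h)⟩,
    fun _ => ⟨StarProof.clc_of_cMil, StarProof.cMil_of_clc⟩⟩
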